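/- Let $p\ge 1$, let $\theta=(\theta_1,\dots,\theta_p)'\in\mathbb{R}^p$ be nonzero with $\|\theta\|_1=\sum_{i=1}^p|\theta_i|<1$, and let $\rho\in\mathbb{R}$ with $|\rho|<1$. Let $(V_n)_{n\ge1}$ be square-integrable, independent and identically distributed real random variables with mean zero and variance $\sigma^2>0$. Consider the process defined for all $n\ge 1$ by $$X_n=\theta_1X_{n-1}+\dots+\theta_pX_{n-p}+\varepsilon_n,\qquad \varepsilon_n=\rho\,\varepsilon_{n-1}+V_n,$$ where $X_0=\varepsilon_0$ is square-integrable and $X_{-1}=\dots=X_{-p}=0$. For $n\ge0$ put $\Phi_n=(X_n,X_{n-1},\dots,X_{n-p+1})'$ and $S_n=\sum_{k=0}^n\Phi_k\Phi_k'+S$, where $S$ is a fixed symmetric positive definite $p\times p$ matrix. For $n\ge1$ let $$\widehat\theta_n=S_{n-1}^{-1}\sum_{k=1}^n\Phi_{k-1}X_k$$ be the least squares estimator of $\theta$, let $\widehat\varepsilon_0=X_0$ and $\widehat\varepsilon_k=X_k-\widehat\theta_n'\Phi_{k-1}$ for $1\le k\le n$ be the residuals at stage $n$, and let $$\widehat D_n=\Big(\sum_{k=0}^n\widehat\varepsilon_k^{\,2}\Big)^{-1}\sum_{k=1}^n\big(\widehat\varepsilon_k-\widehat\varepsilon_{k-1}\big)^2$$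 be the Durbin–Watson statistic. Let $I$ be the identity matrix and $J$ the exchange matrix of order $p$ (ones on the antidiagonal, zeros elsewhere), and set $$\alpha=\frac{1}{(1-\theta_p\rho)(1+\theta_p\rho)},\qquad \beta=(\theta_1+\rho,\ \theta_2-\theta_1\rho,\ \dots,\ \theta_p-\theta_{p-1}\rho)',$$ $$\theta^*=\alpha\,(I-\theta_p\rho J)\,\beta,\qquad \rho^*=\theta_p\,\rho\,\theta^*_p,\qquad D^*=2(1-\rho^*),$$ where $\theta^*_p$ is the $p$-th component of $\theta^*$. Then $$\lim_{n\to\infty}\widehat D_n=D^*\quad\text{almost surely.}$$ -/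

import Mathlib

open MeasureTheory ProbabilityTheory Filter Topology

noncomputable section

namespace DurbinWatson

/-- The autoregressive model of order `p` driven by first-order autoregressive noise:
`X_n = θ_1 X_{n-1} + ⋯ + θ_p X_{n-p} + ε_n` and `ε_n = ρ ε_{n-1} + V_n` for all `n ≥ 1`,
with `X_0 = ε_0` and `X_{-1} = ⋯ = X_{-p} = 0`. The entry `θ i`, `i = 0, …, p - 1`, is the
coefficient `θ_{i+1}`. The values `V 0` and `X n` for `n < -p` are not used. -/
structure IsModel {Ω : Type*} {p : ℕ} (θ : Fin p → ℝ) (ρ : ℝ)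
    (V : ℕ → Ω → ℝ) (ε : ℕ → Ω → ℝ) (X : ℤ → Ω → ℝ) : Prop where
  autoregression : ∀ n : ℕ, 1 ≤ n → ∀ ω : Ω,
    X (n : ℤ) ω = (∑ i : Fin p, θ i * X ((n : ℤ) - ((i : ℕ) : ℤ) - 1) ω) + ε n ω
  noise : ∀ n : ℕ, 1 ≤ n → ∀ ω : Ω, ε n ω = ρ * ε (n - 1) ω + V n ω
  initial : ∀ ω : Ω, X 0 ω = ε 0 ω
  initial_neg : ∀ k : ℕ, 1 ≤ k → k ≤ p → ∀ ω : Ω, X (-(k : ℤ)) ω = 0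

/-! ### Statistics of a trajectory `x : ℤ → ℝ` -/

/-- The lag vector `Φ_n = (x_n, x_{n-1}, …, x_{n-p+1})'`. -/
def lag (p : ℕ) (x : ℤ → ℝ) (n : ℤ) : Fin p → ℝ :=
  fun i => x (n - ((i : ℕ) : ℤ))

/-- `S_n = ∑_{k=0}^n Φ_k Φ_k' + S`. -/
def gram {p : ℕ} (S : Matrix (Fin p) (Fin p) ℝ) (x : ℤ → ℝ) (n : ℕ) :
    Matrix (Fin p) (Fin p) ℝ :=
  (∑ k ∈ Finset.range (n + 1), Matrix.vecMulVec (lag p x (k : ℤ)) (lag p x (k : ℤ))) + S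

/-- The least squares estimator
`θ̂_n = (S_{n-1})⁻¹ ∑_{k=1}^n Φ_{k-1} x_k` of `θ`, for `n ≥ 1`. -/
def thetaHat {p : ℕ} (S : Matrix (Fin p) (Fin p) ℝ) (x : ℤ → ℝ) (n : ℕ) : Fin p → ℝ :=
  Matrix.mulVec (gram S x (n - 1))⁻¹
    (∑ k ∈ Finset.Icc 1 n, x (k : ℤ) • lag p x ((k : ℤ) - 1))

/-- The residuals at stage `n`: `ε̂_0 = x_0`, and `ε̂_k = x_k - θ̂_n' Φ_{k-1}` for
`1 ≤ k ≤ n`. -/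
def residual {p : ℕ} (S : Matrix (Fin p) (Fin p) ℝ) (x : ℤ → ℝ) (n k : ℕ) : ℝ :=
  if k = 0 then x 0
  else x (k : ℤ) - dotProduct (thetaHat S x n) (lag p x ((k : ℤ) - 1))

/-- The Durbin-Watson statistic
`D̂_n = (∑_{k=0}^n ε̂_k²)⁻¹ ∑_{k=1}^n (ε̂_k - ε̂_{k-1})²`, for `n ≥ 1`. -/
def durbinWatson {p : ℕ} (S : Matrix (Fin p) (Fin p) ℝ) (x : ℤ → ℝ) (n : ℕ) : ℝ :=
  (∑ k ∈ Finset.range (n + 1), residual S x n k ^ 2)⁻¹ *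
    ∑ k ∈ Finset.Icc 1 n, (residual S x n k - residual S x n (k - 1)) ^ 2

/-! ### The limiting values -/

/-- The last component `v_p` of a vector `v = (v_1, …, v_p)'`. -/
def lastEntry {p : ℕ} (hp : 1 ≤ p) (v : Fin p → ℝ) : ℝ :=
  v ⟨p - 1, by omega⟩

/-- The exchange matrix of order `p`, with ones on the antidiagonal. -/
def exchange (p : ℕ) : Matrix (Fin p) (Fin p) ℝ :=
  Matrix.of fun i j => if (i : ℕ) + (j : ℕ) + 1 = p then 1 else 0

/-- `α = 1 / ((1 - θ_p ρ) (1 + θ_p ρ))`. -/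
def alpha {p : ℕ} (hp : 1 ≤ p) (θ : Fin p → ℝ) (ρ : ℝ) : ℝ :=
  1 / ((1 - lastEntry hp θ * ρ) * (1 + lastEntry hp θ * ρ))

/-- `β = (θ_1 + ρ, θ_2 - θ_1 ρ, …, θ_p - θ_{p-1} ρ)'`. -/
def beta {p : ℕ} (θ : Fin p → ℝ) (ρ : ℝ) : Fin p → ℝ :=
  fun i => if (i : ℕ) = 0 then θ i + ρ
    else θ i - θ ⟨(i : ℕ) - 1, lt_of_le_of_lt (Nat.sub_le _ _) i.isLt⟩ * ρ

/-- `θ* = α (I - θ_p ρ J) β`, with `J` the exchange matrix. -/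
def thetaStar {p : ℕ} (hp : 1 ≤ p) (θ : Fin p → ℝ) (ρ : ℝ) : Fin p → ℝ :=
  alpha hp θ ρ • Matrix.mulVec (1 - (lastEntry hp θ * ρ) • exchange p) (beta θ ρ)

/-- `ρ* = θ_p ρ θ*_p`. -/
def rhoStar {p : ℕ} (hp : 1 ≤ p) (θ : Fin p → ℝ) (ρ : ℝ) : ℝ :=
  lastEntry hp θ * ρ * lastEntry hp (thetaStar hp θ ρ)

/-- `D* = 2 (1 - ρ*)`. -/
def dStar {p : ℕ} (hp : 1 ≤ p) (θ : Fin p → ℝ) (ρ : ℝ) : ℝ :=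
  2 * (1 - rhoStar hp θ ρ)

end DurbinWatson

end

/-! Write `B` for the delay, `⟨a, b⟩` for the Cesàro mean of `a_k b_k` over `0 ≤ k ≤ n`, `c = θ_p ρ`
and `t = θ*`. Probability enters only through the strong law: almost surely the innovations have the
lagged Cesàro means of a white noise (`ae_isWhite_innovation`). The rest is deterministic,
trajectory by trajectory. Set to zero before time `0`, a trajectory makes `B` a contraction for the
Cesàro norm, and `⟨Ba, Bb⟩ - ⟨a, b⟩` is a boundary term tending to `0`.

Composing the two autoregressive filters gives `V = x - ∑ β_i B^i x + c B^{p+1} x`. Since `β = (I +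
cJ) t`, this reads `V = f + c b`, where `f` and `b` are the forward and backward prediction errors
with coefficients `t` (`innovation_eq`). The innovation is asymptotically orthogonal to the past of
`x`, and time reversal turns `⟨b, B^j x⟩` into `⟨f, B^{p+1-j} x⟩`. Hence `⟨f, B^j x⟩ + c ⟨f,
B^{p+1-j} x⟩ → 0` for `1 ≤ j ≤ p+1`. For `j ≤ p`, pairing `j` with `p+1-j` gives `⟨f, B^j x⟩ → 0`,
so `t` is the limit of least squares. The case `j = p+1` gives `⟨f, Bf⟩ ≈ c t_p ‖f‖²`, that is `‖f -
Bf‖² ≈ 2 (1 - c t_p) ‖f‖²`.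

No limiting autocovariance of `x` is computed: it suffices that `‖∑ u_i B^i x‖²` is eventually at
least a fixed positive multiple of `∑ u_i²`, uniformly in `u`. This gives `θ̂_n → t` and keeps the
denominator of the statistic away from `0`. -/

namespace DurbinWatson

/-! ### Cesàro inner products of causal sequences -/

/-- The sequence `a` delayed by `h` steps. -/
def shift (h : ℕ) : (ℤ → ℝ) →ₗ[ℝ] (ℤ → ℝ) where
  toFun a k := a (k - h)
  map_add' _ _ := rfl
  map_smul' _ _ := rfl

lemma shift_apply (h : ℕ) (a : ℤ → ℝ) (k : ℤ) : shift h a k = a (k - h) := rfl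

lemma shift_shift (g h : ℕ) (a : ℤ → ℝ) : shift g (shift h a) = shift (g + h) a := by
  ext k
  simp only [shift_apply]
  congr 1
  push_cast
  ring

lemma shift_zero (a : ℤ → ℝ) : shift 0 a = a := by
  ext k
  simp [shift_apply]

/-- A sequence that vanishes at negative times. -/
def Causal (a : ℤ → ℝ) : Prop := ∀ k < 0, a k = 0

lemma Causal.comp_shift {a : ℤ → ℝ} (ha : Causal a) (h : ℕ) : Causal (shift h a) :=
  fun k hk => ha _ (by omega)

lemma Causal.sub {a b : ℤ → ℝ} (ha : Causal a) (hb : Causal b) : Causal (a - b) :=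
  fun k hk => by simp [ha k hk, hb k hk]

lemma Causal.sum_smul {ι : Type*} [Fintype ι] {a : ι → ℤ → ℝ} (ha : ∀ i, Causal (a i))
    (u : ι → ℝ) : Causal (∑ i, u i • a i) :=
  fun k hk => by simp [fun i => ha i k hk]

/-- The vector `(a_0, …, a_n) / √(n+1)`. -/
noncomputable def window (n : ℕ) : (ℤ → ℝ) →ₗ[ℝ] EuclideanSpace ℝ (Fin (n + 1)) where
  toFun a := WithLp.toLp 2 fun k => a ((k : ℕ) : ℤ) / √(n + 1)
  map_add' a b := by
    ext k
    simp [add_div]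
  map_smul' c a := by
    ext k
    simp [mul_div_assoc]

/-- The Cesàro mean of `a_k b_k` over `0 ≤ k ≤ n`. -/
noncomputable def cesaro (n : ℕ) (a b : ℤ → ℝ) : ℝ := inner ℝ (window n a) (window n b)

lemma cesaro_eq (n : ℕ) (a b : ℤ → ℝ) :
    cesaro n a b = (∑ k ∈ Finset.range (n + 1), a k * b k) / (n + 1) := by
  have h : (0 : ℝ) ≤ n + 1 := by positivity
  rw [← Fin.sum_univ_eq_sum_range (fun k => a (k : ℤ) * b k), Finset.sum_div]
  simp only [cesaro, window, LinearMap.coe_mk, AddHom.coe_mk, PiLp.inner_apply]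
  refine Finset.sum_congr rfl fun k _ => ?_
  simp only [RCLike.inner_apply, conj_trivial]
  rw [div_mul_div_comm, Real.mul_self_sqrt h, mul_comm]

lemma cesaro_comm (n : ℕ) (a b : ℤ → ℝ) : cesaro n a b = cesaro n b a :=
  real_inner_comm _ _

lemma cesaro_self (n : ℕ) (a : ℤ → ℝ) : cesaro n a a = ‖window n a‖ ^ 2 :=
  real_inner_self_eq_norm_sq _

lemma cesaro_sub_left (n : ℕ) (a b c : ℤ → ℝ) :
    cesaro n (a - b) c = cesaro n a c - cesaro n b c := by
  simp [cesaro, inner_sub_left]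

lemma cesaro_add_left (n : ℕ) (a b c : ℤ → ℝ) :
    cesaro n (a + b) c = cesaro n a c + cesaro n b c := by
  simp [cesaro, inner_add_left]

lemma cesaro_smul_left (n : ℕ) (r : ℝ) (a b : ℤ → ℝ) :
    cesaro n (r • a) b = r * cesaro n a b := by
  simp [cesaro, inner_smul_left]

lemma cesaro_sum_left {ι : Type*} [Fintype ι] (n : ℕ) (u : ι → ℝ) (a : ι → ℤ → ℝ) (b : ℤ → ℝ) :
    cesaro n (∑ i, u i • a i) b = ∑ i, u i * cesaro n (a i) b := by
  simp [cesaro, sum_inner, inner_smul_left]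

lemma cesaro_sub_right (n : ℕ) (a b c : ℤ → ℝ) :
    cesaro n a (b - c) = cesaro n a b - cesaro n a c := by
  simp [cesaro, inner_sub_right]

lemma cesaro_add_right (n : ℕ) (a b c : ℤ → ℝ) :
    cesaro n a (b + c) = cesaro n a b + cesaro n a c := by
  simp [cesaro, inner_add_right]

lemma cesaro_sum_right {ι : Type*} [Fintype ι] (n : ℕ) (u : ι → ℝ) (a : ℤ → ℝ) (b : ι → ℤ → ℝ) :
    cesaro n a (∑ i, u i • b i) = ∑ i, u i * cesaro n a (b i) := by
  simp [cesaro, inner_sum, inner_smul_right]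

lemma abs_cesaro_le (n : ℕ) (a b : ℤ → ℝ) : |cesaro n a b| ≤ ‖window n a‖ * ‖window n b‖ :=
  abs_real_inner_le_norm _ _

/-- The products move one step to the right: the last one leaves the window, and the one that
enters, at time `-1`, is zero. -/
lemma cesaro_shift_one {a b : ℤ → ℝ} (ha : Causal a) (n : ℕ) :
    cesaro n (shift 1 a) (shift 1 b) =
      cesaro n a b - a n / √(n + 1) * (b n / √(n + 1)) := by
  have h : (0 : ℝ) ≤ n + 1 := by positivity
  rw [div_mul_div_comm, Real.mul_self_sqrt h, cesaro_eq, cesaro_eq, ← sub_div,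
    Finset.sum_range_succ', Finset.sum_range_succ _ n]
  simp [shift_apply, ha (-1) (by norm_num)]

lemma norm_window_shift_le {a : ℤ → ℝ} (ha : Causal a) (h n : ℕ) :
    ‖window n (shift h a)‖ ≤ ‖window n a‖ := by
  induction h with
  | zero => rw [shift_zero]
  | succ h ih =>
    refine le_trans ?_ ih
    rw [add_comm h 1, ← shift_shift, ← abs_norm, ← abs_norm (window n (shift h a)), ← sq_le_sq,
      ← cesaro_self, ← cesaro_self, cesaro_shift_one (ha.comp_shift h)]
    nlinarith [sq_nonneg (shift h a n / √(n + 1))]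

lemma abs_div_sqrt_le_norm_window (a : ℤ → ℝ) (n : ℕ) : |a n / √(n + 1)| ≤ ‖window n a‖ := by
  have := PiLp.norm_apply_le (window n a) (Fin.last n)
  simpa [window, abs_div] using this

lemma abs_shift_div_sqrt_le_norm_window {a : ℤ → ℝ} (ha : Causal a) (h n : ℕ) :
    |shift h a n / √(n + 1)| ≤ ‖window n a‖ :=
  (abs_div_sqrt_le_norm_window _ n).trans (norm_window_shift_le ha h n)

lemma norm_window_sum_le {ι : Type*} [Fintype ι] (n : ℕ) (u : ι → ℝ) {a : ι → ℤ → ℝ} {w : ℝ}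
    (ha : ∀ i, ‖window n (a i)‖ ≤ w) : ‖window n (∑ i, u i • a i)‖ ≤ (∑ i, |u i|) * w := by
  rw [map_sum, Finset.sum_mul]
  refine norm_sum_le_of_le _ fun i _ => ?_
  rw [map_smul, norm_smul, Real.norm_eq_abs]
  exact mul_le_mul_of_nonneg_left (ha i) (abs_nonneg _)

/-! ### Boundary terms -/

/-- The causal sequences `a` with `a_n = o(√n)`. -/
structure Negligible (a : ℤ → ℝ) : Prop where
  causal : Causal a
  tendsto : ∀ h : ℕ, Tendsto (fun n : ℕ => shift h a n / √(n + 1)) atTop (𝓝 0)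

lemma Negligible.comp_shift {a : ℤ → ℝ} (ha : Negligible a) (h : ℕ) : Negligible (shift h a) :=
  ⟨ha.causal.comp_shift h, fun g => by simpa only [shift_shift] using ha.tendsto (g + h)⟩

lemma Negligible.sub {a b : ℤ → ℝ} (ha : Negligible a) (hb : Negligible b) :
    Negligible (a - b) :=
  ⟨ha.causal.sub hb.causal, fun h => by
    simpa [sub_div] using (ha.tendsto h).sub (hb.tendsto h)⟩

lemma Negligible.sum_smul {ι : Type*} [Fintype ι] {a : ι → ℤ → ℝ} (ha : ∀ i, Negligible (a i))
    (u : ι → ℝ) : Negligible (∑ i, u i • a i) :=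
  ⟨.sum_smul (fun i => (ha i).causal) u, fun h => by
    have := tendsto_finsetSum Finset.univ fun i _ => ((ha i).tendsto h).const_mul (u i)
    simpa [Finset.sum_div, mul_div_assoc] using this⟩

lemma Negligible.cesaro_shift {a b : ℤ → ℝ} (ha : Negligible a) (hb : Negligible b) (h : ℕ) :
    Tendsto (fun n => cesaro n (shift h a) (shift h b) - cesaro n a b) atTop (𝓝 0) := by
  induction h with
  | zero => simp [shift_zero]
  | succ h ih =>
    have h1 := ((ha.comp_shift h).tendsto 0).mul ((hb.comp_shift h).tendsto 0)
    have h2 := ih.sub h1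
    simp only [shift_zero, mul_zero, sub_zero] at h2
    refine h2.congr fun n => ?_
    rw [add_comm h 1, ← shift_shift, ← shift_shift, cesaro_shift_one (ha.causal.comp_shift h)]
    ring

/-- Asymptotic invariance of lagged Cesàro means under time reversal. -/
lemma Negligible.cesaro_reverse {a : ℤ → ℝ} (ha : Negligible a) {m i j : ℕ} (hi : i ≤ m)
    (hj : j ≤ m) :
    Tendsto (fun n => cesaro n (shift (m - i) a) (shift (m - j) a) -
      cesaro n (shift i a) (shift j a)) atTop (𝓝 0) := by
  have key : ∀ i j : ℕ, i ≤ j → j ≤ m →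
      Tendsto (fun n => cesaro n (shift (m - i) a) (shift (m - j) a) -
        cesaro n (shift i a) (shift j a)) atTop (𝓝 0) := by
    intro i j hij hj
    -- Up to boundary terms, both means equal the mean of `a` against its delay by `j - i`.
    have h1 := (ha.comp_shift (j - i)).cesaro_shift ha (m - j)
    have h2 := ha.cesaro_shift (ha.comp_shift (j - i)) i
    simp only [shift_shift, show m - j + (j - i) = m - i by omega,
      show i + (j - i) = j by omega] at h1 h2
    simpa [cesaro_comm _ a] using h1.sub h2
  rcases le_total i j with h | h
  · exact key i j h hj
  · simpa only [cesaro_comm _ (shift (m - j) a), cesaro_comm _ (shift j a)] using key j i h hi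

/-! ### Stable autoregressions -/

/-- The recursion runs in `h`, with `n` a parameter. Each use multiplies the eventual bound `W` by
`q = ∑ |θ i| < 1`, and the errors add up to at most `δ` because `q δ + (1 - q) δ = δ`. -/
lemma tendsto_zero_of_contraction {p : ℕ} {θ : Fin p → ℝ} (hθ : ∑ i, |θ i| < 1)
    {a b : ℕ → ℕ → ℝ} {W : ℝ} (hW : ∀ h, ∀ᶠ n in atTop, |a h n| ≤ W)
    (hab : ∀ h n, a h n = ∑ i, θ i * a (h + (i + 1)) n + b h n)
    (hb : ∀ h, Tendsto (b h) atTop (𝓝 0)) (h : ℕ) : Tendsto (a h) atTop (𝓝 0) := by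
  set q := ∑ i, |θ i| with hq
  have hq0 : 0 ≤ q := Finset.sum_nonneg fun _ _ => abs_nonneg _
  have key : ∀ δ > 0, ∀ m h, ∀ᶠ n in atTop, |a h n| ≤ q ^ m * W + δ := by
    intro δ hδ m
    induction m with
    | zero =>
      intro h
      filter_upwards [hW h] with n hn
      simp only [pow_zero, one_mul]
      linarith
    | succ m ih =>
      intro h
      have h1 : ∀ᶠ n in atTop, ∀ i : Fin p, |a (h + (i + 1)) n| ≤ q ^ m * W + δ :=
        eventually_all.2 fun i => ih _
      have h2 : ∀ᶠ n in atTop, |b h n| < (1 - q) * δ := by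
        have := (hb h).abs
        rw [abs_zero] at this
        exact this.eventually (gt_mem_nhds (mul_pos (by linarith) hδ))
      filter_upwards [h1, h2] with n h1 h2
      rw [hab]
      have h3 : |∑ i, θ i * a (h + (i + 1)) n| ≤ q * (q ^ m * W + δ) := by
        rw [hq, Finset.sum_mul]
        refine (Finset.abs_sum_le_sum_abs _ _).trans (Finset.sum_le_sum fun i _ => ?_)
        rw [abs_mul]
        exact mul_le_mul_of_nonneg_left (h1 i) (abs_nonneg _)
      refine (abs_add_le _ _).trans ?_
      rw [pow_succ']
      linarith
  rw [Metric.tendsto_atTop']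
  intro η hη
  have hpow : Tendsto (fun m => q ^ m * W) atTop (𝓝 0) := by
    simpa using (tendsto_pow_atTop_nhds_zero_of_lt_one hq0 hθ).mul_const W
  obtain ⟨m, hm⟩ := (hpow.eventually (gt_mem_nhds (half_pos hη))).exists
  obtain ⟨N, hN⟩ := eventually_atTop.1 (key (η / 2) (half_pos hη) m h)
  refine ⟨N, fun n hn => ?_⟩
  rw [Real.dist_eq, sub_zero]
  linarith [hN n hn.le]

/-- `x_k = θ_1 x_{k-1} + ⋯ + θ_p x_{k-p} + e_k` for all `k`, with `e` and `x` causal. -/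
structure IsAR {p : ℕ} (θ : Fin p → ℝ) (e x : ℤ → ℝ) : Prop where
  stable : ∑ i, |θ i| < 1
  causal_input : Causal e
  causal : Causal x
  eq : x = ∑ i : Fin p, θ i • shift (i + 1) x + e

namespace IsAR

variable {p : ℕ} {θ : Fin p → ℝ} {e x : ℤ → ℝ}

lemma shift_eq (H : IsAR θ e x) (h : ℕ) :
    shift h x = ∑ i : Fin p, θ i • shift (h + (i + 1)) x + shift h e := by
  conv_lhs => rw [H.eq]
  simp [shift_shift]

lemma norm_window_le (H : IsAR θ e x) (n : ℕ) :
    ‖window n x‖ ≤ ‖window n e‖ / (1 - ∑ i, |θ i|) := by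
  have h1 := norm_window_sum_le n θ (a := fun i : Fin p => shift (i + 1) x)
    (fun i => norm_window_shift_le H.causal (i + 1) n)
  have h2 : ‖window n x‖ ≤ ‖window n (∑ i : Fin p, θ i • shift (i + 1) x)‖ + ‖window n e‖ := by
    conv_lhs => rw [H.eq, map_add]
    exact norm_add_le _ _
  rw [le_div_iff₀ (by linarith [H.stable])]
  linarith

lemma exists_norm_window_le (H : IsAR θ e x) (he : ∃ W, ∀ n, ‖window n e‖ ≤ W) :
    ∃ W, ∀ n, ‖window n x‖ ≤ W := by
  obtain ⟨W, hW⟩ := he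
  refine ⟨W / (1 - ∑ i, |θ i|), fun n => (H.norm_window_le n).trans ?_⟩
  exact div_le_div_of_nonneg_right (hW n) (by linarith [H.stable])

lemma negligible (H : IsAR θ e x) (hW : ∃ W, ∀ n, ‖window n e‖ ≤ W) (he : Negligible e) :
    Negligible x := by
  obtain ⟨W, hW⟩ := H.exists_norm_window_le hW
  refine ⟨H.causal, tendsto_zero_of_contraction (a := fun h n => shift h x n / √(n + 1))
    (b := fun h n => shift h e n / √(n + 1)) (W := W) H.stable ?_ ?_ he.tendsto⟩
  · exact fun h => .of_forall fun n =>
      (abs_shift_div_sqrt_le_norm_window H.causal h n).trans (hW n)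
  · intro h n
    conv_lhs => rw [H.shift_eq h]
    simp [add_div, Finset.sum_div, mul_div_assoc]

/-- As a function of the lag, the mean of `v` against the delayed `x` obeys the autoregression of
`x`, with an input that tends to zero; so orthogonality to the past passes from input to output. -/
lemma tendsto_cesaro_shift (H : IsAR θ e x) {v : ℤ → ℝ} (hv : ∃ W, ∀ n, ‖window n v‖ ≤ W)
    (he : ∃ W, ∀ n, ‖window n e‖ ≤ W)
    (hve : ∀ h : ℕ, Tendsto (fun n => cesaro n v (shift (h + 1) e)) atTop (𝓝 0)) (h : ℕ) :
    Tendsto (fun n => cesaro n v (shift (h + 1) x)) atTop (𝓝 0) := by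
  obtain ⟨W, hW⟩ := H.exists_norm_window_le he
  obtain ⟨W', hW'⟩ := hv
  refine tendsto_zero_of_contraction (a := fun h n => cesaro n v (shift (h + 1) x))
    (b := fun h n => cesaro n v (shift (h + 1) e)) (W := W' * W) H.stable ?_ ?_ hve h
  · intro h
    refine .of_forall fun n => (abs_cesaro_le _ _ _).trans ?_
    exact mul_le_mul (hW' n) ((norm_window_shift_le H.causal _ n).trans (hW n)) (norm_nonneg _)
      ((norm_nonneg _).trans (hW' n))
  · intro h n
    conv_lhs => rw [H.shift_eq (h + 1)]
    simp only [cesaro_add_right, cesaro_sum_right]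
    congr 1
    refine Finset.sum_congr rfl fun i _ => ?_
    rw [show h + 1 + ((i : ℕ) + 1) = h + (i + 1) + 1 by ring]

/-- The inverse of a stable autoregressive filter is bounded. -/
lemma norm_window_input_le (H : IsAR θ e x) {m : ℕ} (u : Fin m → ℝ) (n : ℕ) :
    ‖window n (∑ i, u i • shift i e)‖ ≤ 2 * ‖window n (∑ i, u i • shift i x)‖ := by
  set y := ∑ i, u i • shift i x with hy
  have hyc : Causal y := .sum_smul (a := fun i : Fin m => shift i x) (fun i => H.causal.comp_shift i) u
  -- Delays commute, so the filter sending `x` to `e` also sends `y` to the same combination of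
  -- delays of `e`.
  have h1 : ∑ i, u i • shift i e = y - ∑ i : Fin p, θ i • shift (i + 1) y := by
    have h2 : ∀ i, shift i e = shift i x - ∑ j : Fin p, θ j • shift (j + 1) (shift i x) := by
      intro i
      conv_rhs => rw [H.shift_eq i]
      conv_lhs => rw [← add_sub_cancel_left (∑ j : Fin p, θ j • shift (i + (j + 1)) x)
        (shift i e), ← H.shift_eq i]
      conv_rhs => rw [← H.shift_eq i]
      simp only [shift_shift]
      congr 1
      refine Finset.sum_congr rfl fun j _ => ?_
      rw [add_comm]
    simp only [h2, hy, smul_sub, Finset.sum_sub_distrib, map_sum, map_smul, Finset.smul_sum]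
    rw [Finset.sum_comm]
    congr 1
    refine Finset.sum_congr rfl fun i _ => Finset.sum_congr rfl fun j _ => ?_
    rw [smul_comm]
  have h3 := norm_window_sum_le n θ (a := fun i : Fin p => shift (i + 1) y)
    (fun i => norm_window_shift_le hyc (i + 1) n)
  rw [h1, map_sub]
  refine (norm_sub_le _ _).trans ?_
  have := mul_le_mul_of_nonneg_right H.stable.le (norm_nonneg (window n y))
  linarith

end IsAR

/-! ### Averages -/

lemma sum_range_eq_sum_residues (w : ℕ → ℝ) {m : ℕ} (hm : 0 < m) (N : ℕ) :
    ∑ k ∈ Finset.range N, w k =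
      ∑ r ∈ Finset.range m, ∑ j ∈ Finset.range (N.count (· ≡ r [MOD m])), w (r + m * j) := by
  induction N with
  | zero => simp
  | succ N ih =>
    have h1 : ∀ r ∈ Finset.range m,
        ∑ j ∈ Finset.range ((N + 1).count (· ≡ r [MOD m])), w (r + m * j) =
          ∑ j ∈ Finset.range (N.count (· ≡ r [MOD m])), w (r + m * j) +
            if N % m = r then w N else 0 := by
      intro r hr
      have hrm : r % m = r := Nat.mod_eq_of_lt (Finset.mem_range.1 hr)
      rw [Nat.count_succ]
      by_cases h : N % m = r
      · rw [if_pos (show N ≡ r [MOD m] by rw [Nat.ModEq, h, hrm]), if_pos h,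
          Finset.sum_range_succ, Nat.count_modEq_card _ hm, hrm, h, if_neg (lt_irrefl r),
          add_zero,
          congrArg w (show r + m * (N / m) = N by rw [← h]; exact Nat.mod_add_div N m)]
      · rw [if_neg (show ¬ N ≡ r [MOD m] by rwa [Nat.ModEq, hrm]), if_neg h]
        simp
    rw [Finset.sum_range_succ, ih, Finset.sum_congr rfl h1, Finset.sum_add_distrib,
      Finset.sum_ite_eq, if_pos (Finset.mem_range.2 (Nat.mod_lt _ hm))]

/-- Because the limits are zero, dividing by `N` instead of the smaller number of terms in a class
only helps, and the density of the class is not needed. -/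
lemma tendsto_average_of_residues {w : ℕ → ℝ} {m : ℕ} (hm : 0 < m)
    (h : ∀ r < m, Tendsto (fun n : ℕ => (∑ j ∈ Finset.range n, w (r + m * j)) / n) atTop (𝓝 0)) :
    Tendsto (fun n : ℕ => (∑ k ∈ Finset.range n, w k) / n) atTop (𝓝 0) := by
  have key : ∀ r ∈ Finset.range m, Tendsto (fun N : ℕ =>
      (∑ j ∈ Finset.range (N.count (· ≡ r [MOD m])), w (r + m * j)) / N) atTop (𝓝 0) := by
    intro r hr
    have hc : Tendsto (fun N : ℕ => N.count (· ≡ r [MOD m])) atTop atTop := by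
      refine tendsto_atTop_mono (fun N => ?_) (Nat.tendsto_div_const_atTop hm.ne')
      rw [Nat.count_modEq_card _ hm]
      exact Nat.le_add_right _ _
    refine squeeze_zero_norm (fun N => ?_)
      (tendsto_norm_zero.comp ((h r (Finset.mem_range.1 hr)).comp hc))
    simp only [Function.comp_apply, norm_div, RCLike.norm_natCast]
    rcases Nat.eq_zero_or_pos (N.count (· ≡ r [MOD m])) with h0 | h0
    · simp [h0]
    · gcongr
      exact Nat.count_le _
  have := tendsto_finsetSum _ key
  simp only [Finset.sum_const_zero] at this
  refine this.congr fun N => ?_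
  rw [sum_range_eq_sum_residues w hm, Finset.sum_div]

lemma tendsto_average_succ_of_shift {w : ℕ → ℝ} {l : ℝ} (s : ℕ)
    (h : Tendsto (fun n : ℕ => (∑ j ∈ Finset.range n, w (s + j)) / n) atTop (𝓝 l)) :
    Tendsto (fun n : ℕ => (∑ k ∈ Finset.range (n + 1), w k) / (n + 1 : ℝ)) atTop (𝓝 l) := by
  suffices H : Tendsto (fun n : ℕ => (∑ k ∈ Finset.range n, w k) / (n : ℝ)) atTop (𝓝 l) by
    simpa using (tendsto_add_atTop_iff_nat 1).2 H
  rw [← tendsto_add_atTop_iff_nat s]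
  have h1 : Tendsto (fun n : ℕ => (∑ k ∈ Finset.range s, w k) / ((n + s : ℕ) : ℝ)) atTop (𝓝 0) :=
    (tendsto_add_atTop_iff_nat (f := fun n : ℕ => (∑ k ∈ Finset.range s, w k) / (n : ℝ)) s).2
      (tendsto_const_div_atTop_nhds_zero_nat _)
  have h2 : Tendsto (fun n : ℕ => (n : ℝ) / ((n + s : ℕ) : ℝ)) atTop (𝓝 1) := by
    simpa using tendsto_natCast_div_add_atTop (𝕜 := ℝ) (s : ℝ)
  have h3 := h1.add (h.mul h2)
  simp only [mul_one, zero_add] at h3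
  refine h3.congr' ?_
  filter_upwards [eventually_gt_atTop 0] with n hn
  have hn' : (n : ℝ) ≠ 0 := by positivity
  rw [add_comm n s, Finset.sum_range_add, add_div, div_mul_div_cancel₀ hn']

/-! ### The innovations -/

/-- The sequence `…, 0, 0, x₀, V_1, V_2, …`, with `x₀` at time zero. -/
def innovation (x₀ : ℝ) (V : ℕ → ℝ) : ℤ → ℝ
  | Int.ofNat 0 => x₀
  | Int.ofNat (n + 1) => V (n + 1)
  | Int.negSucc _ => 0

lemma causal_innovation (x₀ : ℝ) (V : ℕ → ℝ) : Causal (innovation x₀ V) := by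
  intro k hk
  obtain ⟨n, rfl⟩ := Int.eq_negSucc_of_lt_zero hk
  rfl

lemma innovation_natCast {x₀ : ℝ} {V : ℕ → ℝ} {n : ℕ} (hn : 1 ≤ n) :
    innovation x₀ V n = V n := by
  obtain ⟨m, rfl⟩ := Nat.exists_eq_add_of_le' hn
  rfl

lemma tendsto_cesaro_innovation {x₀ l : ℝ} {V : ℕ → ℝ} {h : ℕ}
    (hV : Tendsto (fun n : ℕ => (∑ j ∈ Finset.range n, V (j + 1) * V (j + h + 1)) / n) atTop
      (𝓝 l)) :
    Tendsto (fun n => cesaro n (innovation x₀ V) (shift h (innovation x₀ V))) atTop (𝓝 l) := by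
  simp only [cesaro_eq]
  -- From time `h + 1` on, both factors sit at times at least `1`, so `x₀` has dropped out.
  refine tendsto_average_succ_of_shift
    (w := fun k : ℕ => innovation x₀ V k * shift h (innovation x₀ V) k) (h + 1)
    (hV.congr fun n => ?_)
  congr 1
  refine Finset.sum_congr rfl fun j _ => ?_
  rw [shift_apply, show ((h + 1 + j : ℕ) : ℤ) - h = ((j + 1 : ℕ) : ℤ) by push_cast; ring,
    innovation_natCast (by omega), innovation_natCast (by omega), mul_comm]
  congr 2
  ring

section StrongLaw

variable {Ω : Type*} [MeasurableSpace Ω] {μ : Measure Ω} {U : ℕ → Ω → ℝ}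

/-- Strong law of large numbers for lagged products of centred i.i.d. variables. -/
lemma ae_tendsto_average_lagged_mul [IsProbabilityMeasure μ] (hmeas : ∀ n, Measurable (U n)) (hindep : iIndepFun U μ)
    (hident : ∀ n, IdentDistrib (U n) (U 0) μ μ) (hint : Integrable (U 0) μ)
    (hmean : ∫ ω, U 0 ω ∂μ = 0) {h : ℕ} (hh : h ≠ 0) :
    ∀ᵐ ω ∂μ, Tendsto (fun n : ℕ => (∑ j ∈ Finset.range n, U j ω * U (j + h) ω) / n) atTop
      (𝓝 0) := by
  have hint' : ∀ n, Integrable (U n) μ := fun n => (hident n).integrable_iff.2 hint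
  have hmean' : ∀ n, ∫ ω, U n ω ∂μ = 0 := fun n => (hident n).integral_eq.trans hmean
  -- Lagged products overlap, but within one residue class modulo `h + 1` they use disjoint pairs of
  -- indices. They are then pairwise independent, which is all that the strong law requires.
  have key : ∀ r : ℕ, ∀ᵐ ω ∂μ, Tendsto (fun n : ℕ => (∑ j ∈ Finset.range n,
      U (r + (h + 1) * j) ω * U (r + (h + 1) * j + h) ω) / n) atTop (𝓝 0) := by
    intro r
    have hne : ∀ k, k ≠ k + h := fun k => by omega
    have hlaw := strong_law_ae_real (μ := μ)
      (fun j => U (r + (h + 1) * j) * U (r + (h + 1) * j + h))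
      ((hindep.indepFun (hne _)).integrable_mul (hint' _) (hint' _)) ?_ ?_
    · rw [(hindep.indepFun (hne _)).integral_mul_eq_mul_integral
        (hmeas _).aestronglyMeasurable (hmeas _).aestronglyMeasurable, hmean', zero_mul] at hlaw
      exact hlaw
    · have hmul : ∀ i j, (h + 1) * i + h ≠ (h + 1) * j := by
        intro i j hij
        have := congrArg (· % (h + 1)) hij
        simp only [Nat.mul_add_mod, Nat.mul_mod_right] at this
        rw [Nat.mod_eq_of_lt (Nat.lt_succ_self h)] at this
        exact hh this
      intro i j hij
      have hij' : (h + 1) * i ≠ (h + 1) * j := fun H => hij (Nat.eq_of_mul_eq_mul_left (by omega) H)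
      have h1 := hmul i j
      have h2 := hmul j i
      exact hindep.indepFun_mul_mul hmeas _ _ _ _ (by omega) (by omega) (by omega) (by omega)
    · intro j
      exact (((hident _).trans (hident _).symm).prodMk ((hident _).trans (hident _).symm)
        (hindep.indepFun (hne _)) (hindep.indepFun (hne _))).comp measurable_mul
  filter_upwards [ae_all_iff.2 key] with ω hω
  exact tendsto_average_of_residues (w := fun k => U k ω * U (k + h) ω) (Nat.succ_pos h)
    fun r _ => hω r

lemma ae_tendsto_average_sq (hindep : iIndepFun U μ)
    (hident : ∀ n, IdentDistrib (U n) (U 0) μ μ) (hL2 : MemLp (U 0) 2 μ) :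
    ∀ᵐ ω ∂μ, Tendsto (fun n : ℕ => (∑ j ∈ Finset.range n, U j ω ^ 2) / n) atTop
      (𝓝 (∫ ω, U 0 ω ^ 2 ∂μ)) := by
  have hsq : Measurable fun t : ℝ => t ^ 2 := by fun_prop
  exact strong_law_ae_real (fun j ω => U j ω ^ 2) hL2.integrable_sq
    (fun i j hij => (hindep.indepFun hij).comp hsq hsq) fun j => (hident j).comp hsq

end StrongLaw

/-- The lagged Cesàro means of `v` are those of a white noise of variance `s`. -/
def IsWhite (s : ℝ) (v : ℤ → ℝ) : Prop :=
  ∀ h : ℕ, Tendsto (fun n => cesaro n v (shift h v)) atTop (𝓝 (if h = 0 then s else 0))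

lemma ae_isWhite_innovation {Ω : Type*} [MeasurableSpace Ω] {μ : Measure Ω}
    [IsProbabilityMeasure μ] {V : ℕ → Ω → ℝ} (hmeas : ∀ n, 1 ≤ n → Measurable (V n))
    (hindep : iIndepFun (fun n => V (n + 1)) μ)
    (hident : ∀ n, 1 ≤ n → IdentDistrib (V n) (V 1) μ μ) (hL2 : MemLp (V 1) 2 μ)
    (hmean : ∫ ω, V 1 ω ∂μ = 0) (x₀ : Ω → ℝ) :
    ∀ᵐ ω ∂μ, IsWhite (variance (V 1) μ) (innovation (x₀ ω) fun n => V n ω) := by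
  have hmeas' : ∀ n, Measurable (V (n + 1)) := fun n => hmeas _ (by omega)
  have hident' : ∀ n, IdentDistrib (V (n + 1)) (V (0 + 1)) μ μ := fun n => hident _ (by omega)
  refine ae_all_iff.2 fun h => ?_
  rcases eq_or_ne h 0 with rfl | hh
  · filter_upwards [ae_tendsto_average_sq hindep hident' hL2] with ω hω
    refine tendsto_cesaro_innovation ?_
    rw [if_pos rfl, variance_of_integral_eq_zero (hmeas' 0).aemeasurable hmean]
    simpa [sq] using hω
  · filter_upwards [ae_tendsto_average_lagged_mul hmeas' hindep hident'
      (hL2.integrable one_le_two) hmean hh] with ω hω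
    rw [if_neg hh]
    exact tendsto_cesaro_innovation hω

/-! ### White noise -/

namespace IsWhite

variable {s : ℝ} {v : ℤ → ℝ}

lemma tendsto_cesaro_self (H : IsWhite s v) : Tendsto (fun n => cesaro n v v) atTop (𝓝 s) := by
  simpa [shift_zero] using H 0

lemma exists_norm_window_le (H : IsWhite s v) : ∃ W, ∀ n, ‖window n v‖ ≤ W := by
  obtain ⟨B, hB⟩ := H.tendsto_cesaro_self.bddAbove_range
  refine ⟨√B, fun n => Real.le_sqrt_of_sq_le ?_⟩
  rw [← cesaro_self]
  exact hB ⟨n, rfl⟩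

/-- The last term of a convergent Cesàro mean is negligible: `v_{n+1}² / (n+2)` is the mean at `n+1`
minus `(n+1)/(n+2)` times the mean at `n`. -/
lemma negligible (H : IsWhite s v) (hv : Causal v) : Negligible v := by
  have h0 : Tendsto (fun n : ℕ => v n / √(n + 1)) atTop (𝓝 0) := by
    rw [← tendsto_add_atTop_iff_nat 1]
    have h1 : Tendsto (fun n : ℕ => ((n : ℝ) + 1) / (n + 2)) atTop (𝓝 1) := by
      have := tendsto_natCast_div_add_atTop (𝕜 := ℝ) 1
      refine ((tendsto_add_atTop_iff_nat 1).2 this).congr fun n => ?_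
      push_cast
      ring
    have h2 := ((tendsto_add_atTop_iff_nat 1).2 H.tendsto_cesaro_self).sub
      (H.tendsto_cesaro_self.mul h1)
    rw [mul_one, sub_self] at h2
    have h3 : Tendsto (fun n : ℕ => (v ((n + 1 : ℕ) : ℤ) / √(((n + 1 : ℕ) : ℝ) + 1)) ^ 2) atTop
        (𝓝 0) := by
      refine h2.congr fun n => ?_
      have hn : (0 : ℝ) ≤ ((n + 1 : ℕ) : ℝ) + 1 := by positivity
      rw [cesaro_eq, cesaro_eq, Finset.sum_range_succ _ (n + 1), div_pow, Real.sq_sqrt hn]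
      push_cast
      field_simp
      ring
    refine (tendsto_zero_iff_abs_tendsto_zero _).2 ?_
    simpa [Real.sqrt_sq_eq_abs, Function.comp_def] using h3.sqrt
  refine ⟨hv, fun h => ?_⟩
  rw [← tendsto_add_atTop_iff_nat h]
  refine squeeze_zero_norm (fun n => ?_) (tendsto_norm_zero.comp h0)
  simp only [Function.comp_apply, norm_div, shift_apply, Real.norm_eq_abs,
    Nat.cast_add, abs_of_nonneg (Real.sqrt_nonneg _), add_sub_cancel_right]
  rw [abs_div, abs_of_nonneg (Real.sqrt_nonneg _)]
  gcongr
  simp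

lemma tendsto_cesaro_shift_shift (H : IsWhite s v) (hv : Causal v) (i j : ℕ) :
    Tendsto (fun n => cesaro n (shift i v) (shift j v)) atTop (𝓝 (if i = j then s else 0)) := by
  have key : ∀ i j : ℕ, i ≤ j → Tendsto (fun n => cesaro n (shift i v) (shift j v)) atTop
      (𝓝 (if i = j then s else 0)) := by
    intro i j hij
    have h1 := ((H.negligible hv).cesaro_shift ((H.negligible hv).comp_shift (j - i)) i).add
      (H (j - i))
    simp only [shift_shift, show i + (j - i) = j by omega, sub_add_cancel, zero_add] at h1
    convert h1 using 3
    omega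
  rcases le_total i j with h | h
  · exact key i j h
  · simpa only [cesaro_comm _ (shift i v), eq_comm (a := i)] using key j i h

/-- The Gram matrix of the first `m` delays tends entrywise to `s I`. Entrywise error `η` costs at
most `η m ≤ s / 2` in the quadratic form. One threshold serves all `u`, so `u` may later depend on
`n`. -/
lemma eventually_le_norm_sq (H : IsWhite s v) (hv : Causal v) (hs : 0 < s) (m : ℕ) :
    ∀ᶠ n in atTop, ∀ u : Fin m → ℝ,
      s / 2 * ∑ i, u i ^ 2 ≤ ‖window n (∑ i : Fin m, u i • shift i v)‖ ^ 2 := by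
  set η := s / (2 * (m + 1)) with hη
  have hη0 : 0 < η := by positivity
  have h1 : ∀ᶠ n in atTop, ∀ i j : Fin m,
      |cesaro n (shift i v) (shift j v) - if i = j then s else 0| ≤ η := by
    refine eventually_all.2 fun i => eventually_all.2 fun j => ?_
    have := H.tendsto_cesaro_shift_shift hv i j
    simp only [Fin.val_inj] at this
    filter_upwards [Metric.tendsto_nhds.1 this η hη0] with n hn
    exact (Real.dist_eq _ _ ▸ hn).le
  filter_upwards [h1] with n hn u
  rw [← cesaro_self, cesaro_sum_left]
  have h2 : ∀ i, (u i ^ 2 * s - ∑ j, η * (u i ^ 2 + u j ^ 2) / 2) ≤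
      u i * cesaro n (shift i v) (∑ j : Fin m, u j • shift j v) := by
    intro i
    rw [cesaro_sum_right, Finset.mul_sum]
    have h3 : u i ^ 2 * s = ∑ j, u i * u j * if i = j then s else 0 := by
      simp [sq]
    rw [h3, ← Finset.sum_sub_distrib]
    refine Finset.sum_le_sum fun j _ => ?_
    have h4 : |u i * u j * (cesaro n (shift i v) (shift j v) - if i = j then s else 0)| ≤
        (u i ^ 2 + u j ^ 2) / 2 * η := by
      rw [abs_mul]
      refine mul_le_mul ?_ (hn i j) (abs_nonneg _) (by positivity)
      rw [abs_le]
      constructor <;> nlinarith [sq_nonneg (u i + u j), sq_nonneg (u i - u j)]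
    have := (abs_le.1 h4).1
    nlinarith
  refine le_trans ?_ (Finset.sum_le_sum fun i _ => h2 i)
  have h5 : ∑ i, (u i ^ 2 * s - ∑ j, η * (u i ^ 2 + u j ^ 2) / 2) =
      (s - η * m) * ∑ i, u i ^ 2 := by
    simp only [Finset.sum_sub_distrib, ← Finset.sum_div, ← Finset.mul_sum, ← Finset.sum_mul,
      Finset.sum_add_distrib, Finset.sum_const, Finset.card_univ, Fintype.card_fin, nsmul_eq_mul]
    ring
  rw [h5]
  refine mul_le_mul_of_nonneg_right ?_ (Finset.sum_nonneg fun i _ => sq_nonneg _)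
  have h6 : η * (m + 1) = s / 2 := by
    rw [hη]
    field_simp
  linarith

end IsWhite

/-! ### The autoregression driven by autoregressive noise -/

/-- `x` is an autoregression driven by a first-order autoregression driven by white noise. -/
structure IsARNoise {p : ℕ} (θ : Fin p → ℝ) (ρ s : ℝ) (v e x : ℤ → ℝ) : Prop where
  noise : IsAR (fun _ : Fin 1 => ρ) v e
  autoregression : IsAR θ e x
  white : IsWhite s v
  pos : 0 < s

/-- The error of the linear prediction of `x_k` by `t_1 x_{k-1} + ⋯ + t_p x_{k-p}`. -/
def predictionError {p : ℕ} (t : Fin p → ℝ) (x : ℤ → ℝ) : ℤ → ℝ :=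
  x - ∑ i : Fin p, t i • shift (i + 1) x

/-- The error of the prediction of `x_{k-p-1}` by `t_1 x_{k-p} + ⋯ + t_p x_{k-1}`. -/
def backwardError {p : ℕ} (t : Fin p → ℝ) (x : ℤ → ℝ) : ℤ → ℝ :=
  shift (p + 1) x - ∑ i : Fin p, t i • shift (p - i) x

lemma predictionError_eq_sum_cons {p : ℕ} (t : Fin p → ℝ) (x : ℤ → ℝ) :
    predictionError t x =
      ∑ i : Fin (p + 1), (Fin.cons 1 (-t) : Fin (p + 1) → ℝ) i • shift i x := by
  simp [predictionError, Fin.sum_univ_succ, shift_zero, sub_eq_add_neg]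

lemma predictionError_sub {p : ℕ} (t t' : Fin p → ℝ) (x : ℤ → ℝ) :
    predictionError t x - predictionError t' x = ∑ i : Fin p, (t' i - t i) • shift (i + 1) x := by
  simp [predictionError, sub_smul]

lemma shift_predictionError {p : ℕ} (t : Fin p → ℝ) (x : ℤ → ℝ) :
    shift 1 (predictionError t x) = shift 1 x - ∑ i : Fin p, t i • shift (i + 2) x := by
  simp only [predictionError, map_sub, map_sum, map_smul, shift_shift]
  congr 1
  refine Finset.sum_congr rfl fun i _ => ?_
  rw [show 1 + ((i : ℕ) + 1) = i + 2 by ring]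

namespace IsARNoise

variable {p : ℕ} {θ : Fin p → ℝ} {ρ s : ℝ} {v e x : ℤ → ℝ}

lemma exists_norm_window_le (H : IsARNoise θ ρ s v e x) : ∃ W, ∀ n, ‖window n x‖ ≤ W :=
  H.autoregression.exists_norm_window_le
    (H.noise.exists_norm_window_le H.white.exists_norm_window_le)

lemma negligible (H : IsARNoise θ ρ s v e x) : Negligible x := by
  have hv := H.white.exists_norm_window_le
  exact H.autoregression.negligible (H.noise.exists_norm_window_le hv)
    (H.noise.negligible hv (H.white.negligible H.noise.causal_input))

lemma tendsto_cesaro_innovation_shift (H : IsARNoise θ ρ s v e x) {h : ℕ} (hh : h ≠ 0) :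
    Tendsto (fun n => cesaro n v (shift h x)) atTop (𝓝 0) := by
  obtain ⟨h, rfl⟩ := Nat.exists_eq_succ_of_ne_zero hh
  have hv := H.white.exists_norm_window_le
  refine H.autoregression.tendsto_cesaro_shift hv (H.noise.exists_norm_window_le hv)
    (H.noise.tendsto_cesaro_shift hv hv fun h => ?_) h
  simpa using H.white (h + 1)

lemma eventually_le_norm_sq (H : IsARNoise θ ρ s v e x) (m : ℕ) :
    ∀ᶠ n in atTop, ∀ u : Fin m → ℝ,
      s / 32 * ∑ i, u i ^ 2 ≤ ‖window n (∑ i : Fin m, u i • shift i x)‖ ^ 2 := by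
  filter_upwards [H.white.eventually_le_norm_sq H.noise.causal_input H.pos m] with n hn u
  have h1 := H.noise.norm_window_input_le u n
  have h2 := H.autoregression.norm_window_input_le u n
  have h3 := hn u
  -- Undoing each of the two filters costs a factor `2`; squaring `4` turns `s / 2` into `s / 32`.
  have h4 : ‖window n (∑ i : Fin m, u i • shift i v)‖ ≤
      4 * ‖window n (∑ i : Fin m, u i • shift i x)‖ := by linarith
  have h5 := pow_le_pow_left₀ (norm_nonneg _) h4 2
  rw [mul_pow] at h5
  linarith

end IsARNoise

/-! ### Yule–Walker relations -/

namespace IsARNoise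

variable {q : ℕ} {θ t : Fin (q + 1) → ℝ} {ρ s c : ℝ} {v e x : ℤ → ℝ}

/-- The coefficients of `(1 - ρB)(1 - ∑ θ_i B^i)` are `1`, `-β_i` and finally `c`; `ht` splits each
`β_i` between the forward error and the reversed one. -/
lemma innovation_eq (H : IsARNoise θ ρ s v e x) (hc : c = θ (Fin.last q) * ρ)
    (ht : ∀ i, beta θ ρ i = t i + c * t i.rev) :
    v = predictionError t x + c • backwardError t x := by
  have hx : ∀ k, e k = x k - ∑ i : Fin (q + 1), θ i * x (k - ((i : ℕ) + 1)) := by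
    intro k
    have := congrFun H.autoregression.eq k
    simp only [Pi.add_apply, Finset.sum_apply, Pi.smul_apply, smul_eq_mul, shift_apply] at this
    push_cast at this
    linarith
  have he : ∀ k, v k = e k - ρ * e (k - 1) := by
    intro k
    have := congrFun H.noise.eq k
    simp [shift_apply] at this
    linarith
  ext k
  set y : ℕ → ℝ := fun i => x (k - (i + 1)) with hy
  have h1 : ∑ i : Fin (q + 1), beta θ ρ i * y i =
      ρ * y 0 + ∑ i : Fin (q + 1), θ i * y i -
        ρ * (∑ i : Fin (q + 1), θ i * y (i + 1) - θ (Fin.last q) * y (q + 1)) := by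
    rw [Fin.sum_univ_succ, Fin.sum_univ_succ (fun i : Fin (q + 1) => θ i * y i),
      Fin.sum_univ_castSucc (fun i : Fin (q + 1) => θ i * y (i + 1))]
    have h2 : ∀ i : Fin q, beta θ ρ i.succ = θ i.succ - θ i.castSucc * ρ := fun i => by
      simp only [beta, Fin.val_succ, Nat.succ_ne_zero, if_false]
      rfl
    simp only [h2, sub_mul, Finset.sum_sub_distrib]
    simp [beta, Finset.mul_sum]
    have h3 : ∑ i : Fin q, θ i.castSucc * ρ * y (i + 1) =
        ∑ i : Fin q, ρ * (θ i.castSucc * y (i + 1)) :=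
      Finset.sum_congr rfl fun i _ => by ring
    rw [h3, ← Finset.mul_sum]
    ring
  have h4 : ∑ i : Fin (q + 1), beta θ ρ i * y i =
      ∑ i : Fin (q + 1), t i * y i + c * ∑ i : Fin (q + 1), t i * y (q - i) := by
    simp only [ht, add_mul, Finset.sum_add_distrib, mul_assoc, ← Finset.mul_sum]
    congr 2
    rw [← Equiv.sum_comp Fin.revPerm]
    refine Finset.sum_congr rfl fun i _ => ?_
    simp [Fin.val_rev]
  rw [he, hx, hx]
  simp only [predictionError, backwardError, Pi.add_apply, Pi.sub_apply, Finset.sum_apply,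
    Pi.smul_apply, smul_eq_mul, shift_apply]
  have h5 : ∀ i : Fin (q + 1), x (k - 1 - ((i : ℕ) + 1)) = y (i + 1) := fun i => by
    simp only [hy]
    congr 1
    push_cast
    ring
  have h6 : ∀ i : Fin (q + 1), x (k - ((q + 1 - i : ℕ) : ℤ)) = y (q - i) := fun i => by
    simp only [hy]
    congr 1
    have := i.is_le
    omega
  have h7 : x (k - ((q + 1 + 1 : ℕ) : ℤ)) = y (q + 1) := by
    simp only [hy]
    congr 1
  have h8 : x (k - 1) = y 0 := by simp [hy]
  have h9 : ∀ i : Fin (q + 1), x (k - (((i : ℕ) + 1 : ℕ) : ℤ)) = y i := fun i => by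
    simp [hy]
  have h10 : ∀ i : Fin (q + 1), x (k - (((i : ℕ) : ℤ) + 1)) = y i := fun i => rfl
  simp only [h5, h6, h7, h8, h9, h10]
  rw [hc] at h4 ⊢
  linarith

lemma tendsto_cesaro_backwardError (H : IsARNoise θ ρ s v e x) (t : Fin (q + 1) → ℝ) {j : ℕ}
    (hj : j ≤ q + 2) :
    Tendsto (fun n => cesaro n (backwardError t x) (shift j x) -
      cesaro n (predictionError t x) (shift (q + 2 - j) x)) atTop (𝓝 0) := by
  have h1 : ∀ i ≤ q + 2, Tendsto (fun n => cesaro n (shift (q + 2 - i) x) (shift j x) -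
      cesaro n (shift i x) (shift (q + 2 - j) x)) atTop (𝓝 0) := by
    intro i hi
    have := H.negligible.cesaro_reverse hi (Nat.sub_le (q + 2) j)
    rwa [Nat.sub_sub_self hj] at this
  have h2 := (h1 0 (Nat.zero_le _)).sub (tendsto_finsetSum Finset.univ
    fun (i : Fin (q + 1)) _ => (h1 (i + 1) (by omega)).const_mul (t i))
  simp only [mul_zero, Finset.sum_const_zero, sub_zero] at h2
  refine h2.congr fun n => ?_
  have h3 : ∀ i : Fin (q + 1), q + 2 - ((i : ℕ) + 1) = q + 1 - i := fun i => by omega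
  simp only [backwardError, predictionError, cesaro_sub_left, cesaro_sum_left, mul_sub,
    Finset.sum_sub_distrib, h3, shift_zero, Nat.sub_zero]
  ring

/-- Orthogonality of the innovation to the past, with the backward error replaced by the forward one
through time reversal. -/
lemma tendsto_yuleWalker (H : IsARNoise θ ρ s v e x) (hc : c = θ (Fin.last q) * ρ)
    (ht : ∀ i, beta θ ρ i = t i + c * t i.rev) {j : ℕ} (hj0 : j ≠ 0) (hj : j ≤ q + 2) :
    Tendsto (fun n => cesaro n (predictionError t x) (shift j x) +
      c * cesaro n (predictionError t x) (shift (q + 2 - j) x)) atTop (𝓝 0) := by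
  have h1 := (H.tendsto_cesaro_innovation_shift hj0).sub
    ((H.tendsto_cesaro_backwardError t hj).const_mul c)
  rw [mul_zero, sub_zero] at h1
  refine h1.congr fun n => ?_
  rw [H.innovation_eq hc ht, cesaro_add_left, cesaro_smul_left]
  ring

/-- The relations at `j` and `q + 2 - j` form a linear system in the same two means, with
determinant `1 - c ^ 2 ≠ 0`. -/
lemma tendsto_cesaro_predictionError_shift (H : IsARNoise θ ρ s v e x)
    (hc : c = θ (Fin.last q) * ρ) (hc1 : |c| < 1) (ht : ∀ i, beta θ ρ i = t i + c * t i.rev)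
    {j : ℕ} (hj0 : j ≠ 0) (hj : j ≤ q + 1) :
    Tendsto (fun n => cesaro n (predictionError t x) (shift j x)) atTop (𝓝 0) := by
  have h1 := H.tendsto_yuleWalker hc ht hj0 (by omega)
  have h2 := H.tendsto_yuleWalker hc ht (j := q + 2 - j) (by omega) (by omega)
  rw [Nat.sub_sub_self (by omega)] at h2
  have hc2 : 1 - c ^ 2 ≠ 0 := by
    have := (sq_lt_one_iff_abs_lt_one c).2 hc1
    linarith
  have h3 := (h1.sub (h2.const_mul c)).div_const (1 - c ^ 2)
  simp only [mul_zero, sub_zero, zero_div] at h3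
  refine h3.congr fun n => ?_
  field_simp
  ring

/-- The energy of the increments of the optimal prediction error. -/
lemma tendsto_norm_sq_increment (H : IsARNoise θ ρ s v e x)
    (hc : c = θ (Fin.last q) * ρ) (hc1 : |c| < 1) (ht : ∀ i, beta θ ρ i = t i + c * t i.rev) :
    Tendsto (fun n =>
      ‖window n (predictionError t x - shift 1 (predictionError t x))‖ ^ 2 -
        2 * (1 - c * t (Fin.last q)) * ‖window n (predictionError t x)‖ ^ 2) atTop (𝓝 0) := by
  set f := predictionError t x with hf
  have hfn : Negligible f :=
    H.negligible.sub (.sum_smul (fun i => H.negligible.comp_shift _) t)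
  have hr := fun j hj0 hj => H.tendsto_cesaro_predictionError_shift hc hc1 ht (j := j) hj0 hj
  rw [← hf] at hr
  have h0 : Tendsto (fun n => cesaro n f f - cesaro n f x) atTop (𝓝 0) := by
    have := (tendsto_finsetSum Finset.univ
      fun (i : Fin (q + 1)) _ => (hr (i + 1) (by omega) (by omega)).const_mul (t i)).neg
    simp only [mul_zero, Finset.sum_const_zero, neg_zero] at this
    refine this.congr fun n => ?_
    rw [show cesaro n f f = cesaro n f (x - ∑ i : Fin (q + 1), t i • shift (i + 1) x) from rfl,
      cesaro_sub_right, cesaro_sum_right]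
    ring
  -- Of the delays of `x` making up `shift 1 f`, only the longest, `q + 2`, is not asymptotically
  -- orthogonal to `f`.
  have h1 : Tendsto (fun n => cesaro n f (shift 1 f) +
      t (Fin.last q) * cesaro n f (shift (q + 2) x)) atTop (𝓝 0) := by
    have := (hr 1 (by omega) (by omega)).sub (tendsto_finsetSum Finset.univ
      fun (i : Fin q) _ => (hr (i + 2) (by omega) (by omega)).const_mul (t i.castSucc))
    simp only [mul_zero, Finset.sum_const_zero, sub_zero] at this
    refine this.congr fun n => ?_
    have h2 : shift 1 f = shift 1 x - ∑ i : Fin (q + 1), t i • shift (i + 2) x :=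
      shift_predictionError t x
    rw [h2, cesaro_sub_right, cesaro_sum_right, Fin.sum_univ_castSucc]
    simp only [Fin.val_castSucc, Fin.val_last]
    ring
  -- The extreme relation evaluates that remaining mean as `-c` times the mean of `f x`, which `h0`
  -- identifies with the energy of `f`.
  have h2 := H.tendsto_yuleWalker hc ht (j := q + 2) (by omega) le_rfl
  rw [Nat.sub_self, shift_zero, ← hf] at h2
  have h3 := hfn.cesaro_shift hfn 1
  have h4 := ((h3.sub (h1.const_mul 2)).add (h2.const_mul (2 * t (Fin.last q)))).add
    (h0.const_mul (2 * c * t (Fin.last q)))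
  simp only [mul_zero, sub_zero, add_zero] at h4
  refine h4.congr fun n => ?_
  rw [← cesaro_self, ← cesaro_self, cesaro_sub_left, cesaro_sub_right, cesaro_sub_right,
    cesaro_comm n (shift 1 f) f]
  ring

end IsARNoise

/-! ### Statistics in terms of Cesàro means -/

section Statistics

variable {p : ℕ} {S : Matrix (Fin p) (Fin p) ℝ} {x : ℤ → ℝ}

lemma succ_mul_cesaro (n : ℕ) (a b : ℤ → ℝ) :
    (n + 1 : ℝ) * cesaro n a b = ∑ k ∈ Finset.range (n + 1), a k * b k := by
  rw [cesaro_eq]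
  field_simp

lemma sum_Icc_one (n : ℕ) (f : ℕ → ℝ) :
    ∑ k ∈ Finset.Icc 1 n, f k = ∑ k ∈ Finset.range n, f (k + 1) := by
  rw [show Finset.Icc 1 n = Finset.Ico 1 (n + 1) by ext; simp, Finset.sum_Ico_eq_sum_range]
  simp [add_comm]

/-- Delays are at least one, so the term at time `0` vanishes and a sum of lag vectors up to `n - 1`
is a mean over the full window up to `n`. -/
lemma gram_apply (hx : Causal x) {n : ℕ} (hn : 1 ≤ n) (i j : Fin p) :
    gram S x (n - 1) i j =
      (n + 1) * cesaro n (shift (i + 1) x) (shift (j + 1) x) + S i j := by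
  obtain ⟨n, rfl⟩ := Nat.exists_eq_add_of_le' hn
  rw [succ_mul_cesaro, Finset.sum_range_succ']
  have h0 : shift (i + 1) x ((0 : ℕ) : ℤ) = 0 := hx _ (by push_cast; omega)
  rw [h0, zero_mul, add_zero]
  simp only [gram, Matrix.add_apply, Matrix.sum_apply, Matrix.vecMulVec_apply, lag, shift_apply,
    Nat.add_sub_cancel]
  congr 1
  refine Finset.sum_congr rfl fun k _ => ?_
  congr 2 <;> push_cast <;> ring

lemma gram_posDef (hS : S.PosDef) (n : ℕ) : (gram S x n).PosDef := by
  refine Matrix.PosDef.posSemidef_add (Matrix.posSemidef_sum _ fun k _ => ?_) hS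
  simpa using Matrix.posSemidef_vecMulVec_self_star (lag p x (k : ℤ))

lemma sum_smul_lag_apply (hx : Causal x) (n : ℕ) (i : Fin p) :
    (∑ k ∈ Finset.Icc 1 n, x (k : ℤ) • lag p x ((k : ℤ) - 1)) i =
      (n + 1) * cesaro n x (shift (i + 1) x) := by
  have h0 : shift (i + 1) x ((0 : ℕ) : ℤ) = 0 := hx _ (by push_cast; omega)
  rw [succ_mul_cesaro, Finset.sum_range_succ', h0, mul_zero, add_zero, Finset.sum_apply,
    sum_Icc_one n fun k => (x (k : ℤ) • lag p x ((k : ℤ) - 1)) i]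
  refine Finset.sum_congr rfl fun k _ => ?_
  simp only [Pi.smul_apply, smul_eq_mul, lag, shift_apply]
  congr 2
  push_cast
  ring

/-- The normal equations for `θ̂_n - t`. -/
lemma gram_mulVec_thetaHat_sub (hx : Causal x) (hS : S.PosDef) {n : ℕ} (hn : 1 ≤ n)
    (t : Fin p → ℝ) (i : Fin p) :
    (gram S x (n - 1)).mulVec (thetaHat S x n - t) i =
      (n + 1) * cesaro n (predictionError t x) (shift (i + 1) x) - S.mulVec t i := by
  have hdet : IsUnit (gram S x (n - 1)).det :=
    (Matrix.isUnit_iff_isUnit_det _).1 (gram_posDef hS _).isUnit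
  have hG : (gram S x (n - 1)).mulVec t i = (n + 1) *
      ∑ j : Fin p, t j * cesaro n (shift (j + 1) x) (shift (i + 1) x) + S.mulVec t i := by
    simp only [Matrix.mulVec, dotProduct, gram_apply hx hn, add_mul, Finset.sum_add_distrib,
      Finset.mul_sum]
    simp only [cesaro_comm n (shift (i + 1) x), mul_assoc, mul_comm (t _)]
  rw [Matrix.mulVec_sub, thetaHat, Matrix.mulVec_mulVec, Matrix.mul_nonsing_inv _ hdet,
    Matrix.one_mulVec, Pi.sub_apply, sum_smul_lag_apply hx, predictionError, cesaro_sub_left,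
    cesaro_sum_left, hG]
  ring

/-- Basic inequality for the least squares estimator. -/
lemma norm_sq_thetaHat_sub_le (hx : Causal x) (hS : S.PosDef) {n : ℕ} (hn : 1 ≤ n)
    (t : Fin p → ℝ) :
    ‖window n (∑ i : Fin p, (thetaHat S x n i - t i) • shift (i + 1) x)‖ ^ 2 ≤
      ∑ i : Fin p, (thetaHat S x n i - t i) *
        (cesaro n (predictionError t x) (shift (i + 1) x) - S.mulVec t i / (n + 1)) := by
  set d := thetaHat S x n - t with hd
  have hn0 : (0 : ℝ) < n + 1 := by positivity
  have h1 : d ⬝ᵥ (gram S x (n - 1)).mulVec d =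
      (n + 1) * ‖window n (∑ i : Fin p, d i • shift (i + 1) x)‖ ^ 2 + d ⬝ᵥ S.mulVec d := by
    rw [← cesaro_self, cesaro_sum_left]
    simp only [cesaro_sum_right, dotProduct, Matrix.mulVec, gram_apply hx hn, Finset.mul_sum,
      ← Finset.sum_add_distrib]
    refine Finset.sum_congr rfl fun i _ => Finset.sum_congr rfl fun j _ => ?_
    ring
  -- The contribution of `S` is nonnegative and can be discarded.
  have h2 : 0 ≤ d ⬝ᵥ S.mulVec d := by
    simpa using hS.posSemidef.dotProduct_mulVec_nonneg d
  have h3 : d ⬝ᵥ (gram S x (n - 1)).mulVec d = (n + 1) * ∑ i : Fin p, d i *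
        (cesaro n (predictionError t x) (shift (i + 1) x) - S.mulVec t i / (n + 1)) := by
    rw [dotProduct, Finset.mul_sum]
    refine Finset.sum_congr rfl fun i _ => ?_
    rw [hd, gram_mulVec_thetaHat_sub hx hS hn t i]
    field_simp
  have h4 : (n + 1 : ℝ) * ‖window n (∑ i : Fin p, d i • shift (i + 1) x)‖ ^ 2 ≤
      (n + 1) * ∑ i : Fin p, d i *
        (cesaro n (predictionError t x) (shift (i + 1) x) - S.mulVec t i / (n + 1)) := by
    linarith
  exact le_of_mul_le_mul_left h4 hn0

lemma residual_eq (hx : Causal x) (n k : ℕ) :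
    residual S x n k = predictionError (thetaHat S x n) x k := by
  rw [residual]
  split_ifs with hk
  · subst hk
    have h0 : ∀ i : Fin p, shift (i + 1) x ((0 : ℕ) : ℤ) = 0 := fun i => hx _ (by push_cast; omega)
    simp only [predictionError, Pi.sub_apply, Finset.sum_apply, Pi.smul_apply, h0]
    simp
  · simp only [predictionError, Pi.sub_apply, Finset.sum_apply, Pi.smul_apply, smul_eq_mul,
      dotProduct, lag, shift_apply]
    congr 1
    refine Finset.sum_congr rfl fun i _ => ?_
    congr 2
    push_cast
    ring

/-- The window counts the increment at time `0`, equal to `x 0`, whereas the statistic starts at `k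
= 1`; hence the correction. -/
lemma durbinWatson_eq (hx : Causal x) (n : ℕ) :
    durbinWatson S x n =
      (‖window n (predictionError (thetaHat S x n) x -
          shift 1 (predictionError (thetaHat S x n) x))‖ ^ 2 - x 0 ^ 2 / (n + 1)) /
        ‖window n (predictionError (thetaHat S x n) x)‖ ^ 2 := by
  set f := predictionError (thetaHat S x n) x with hf
  have hn0 : (0 : ℝ) < n + 1 := by positivity
  have hfc : Causal f :=
    hx.sub (.sum_smul (a := fun i : Fin p => shift (i + 1) x) (fun i => hx.comp_shift _) _)
  have hf0 : f 0 = x 0 := by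
    have := residual_eq (S := S) hx n 0
    simpa [residual] using this.symm
  have h1 : ∑ k ∈ Finset.range (n + 1), residual S x n k ^ 2 = (n + 1) * ‖window n f‖ ^ 2 := by
    rw [← cesaro_self, succ_mul_cesaro]
    exact Finset.sum_congr rfl fun k _ => by rw [residual_eq hx, sq]
  have h2 : ∑ k ∈ Finset.Icc 1 n, (residual S x n k - residual S x n (k - 1)) ^ 2 =
      (n + 1) * (‖window n (f - shift 1 f)‖ ^ 2 - x 0 ^ 2 / (n + 1)) := by
    rw [mul_sub, mul_div_cancel₀ _ hn0.ne', ← cesaro_self, succ_mul_cesaro,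
      Finset.sum_range_succ', sum_Icc_one n
        fun k => (residual S x n k - residual S x n (k - 1)) ^ 2]
    have h3 : (f - shift 1 f) ((0 : ℕ) : ℤ) = x 0 := by
      simp [shift_apply, hfc (-1) (by norm_num), hf0]
    rw [h3, sq (x 0), add_sub_cancel_right]
    refine Finset.sum_congr rfl fun k _ => ?_
    rw [residual_eq hx, residual_eq hx, ← hf, sq]
    simp [shift_apply]
  rw [durbinWatson, h1, h2, mul_comm, ← div_eq_mul_inv, mul_div_mul_left _ _ hn0.ne']

lemma durbinWatson_congr {x y : ℤ → ℝ} (h : ∀ k : ℤ, -(p : ℤ) ≤ k → x k = y k) (n : ℕ) :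
    durbinWatson S x n = durbinWatson S y n := by
  have hlag : ∀ k : ℤ, 0 ≤ k → lag p x k = lag p y k := fun k hk => by
    ext i
    exact h _ (by omega)
  have hgram : gram S x (n - 1) = gram S y (n - 1) := by
    simp only [gram]
    congr 1
    exact Finset.sum_congr rfl fun k _ => by rw [hlag _ (by positivity)]
  have htheta : thetaHat S x n = thetaHat S y n := by
    rw [thetaHat, thetaHat, hgram]
    congr 1
    refine Finset.sum_congr rfl fun k hk => ?_
    have := (Finset.mem_Icc.1 hk).1
    rw [h _ (by omega), hlag _ (by omega)]
  have hres : ∀ k, residual S x n k = residual S y n k := fun k => by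
    simp only [residual]
    split_ifs with hk
    · exact h _ (by omega)
    · rw [h _ (by omega), htheta, hlag _ (by omega)]
  simp only [durbinWatson, hres]

end Statistics

/-! ### Convergence -/

lemma tendsto_norm_sq_sub_norm_sq {E : ℕ → Type*} [∀ n, NormedAddCommGroup (E n)]
    {a b : ∀ n, E n} {W : ℝ} (hb : ∀ n, ‖b n‖ ≤ W)
    (h : Tendsto (fun n => ‖a n - b n‖) atTop (𝓝 0)) :
    Tendsto (fun n => ‖a n‖ ^ 2 - ‖b n‖ ^ 2) atTop (𝓝 0) := by
  have h1 := h.mul (h.add_const (2 * W))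
  rw [zero_mul] at h1
  refine squeeze_zero_norm (fun n => ?_) h1
  have h2 := abs_norm_sub_norm_le (a n) (b n)
  have h3 : ‖a n‖ ≤ ‖a n - b n‖ + ‖b n‖ := by simpa using norm_add_le (a n - b n) (b n)
  rw [sq_sub_sq, Real.norm_eq_abs, abs_mul, abs_of_nonneg (by positivity : 0 ≤ ‖a n‖ + ‖b n‖),
    mul_comm]
  exact mul_le_mul h2 (by linarith [hb n]) (by positivity) (norm_nonneg _)

namespace IsARNoise

variable {q : ℕ} {θ t : Fin (q + 1) → ℝ} {ρ s c : ℝ} {v e x : ℤ → ℝ}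
  {S : Matrix (Fin (q + 1)) (Fin (q + 1)) ℝ}

lemma tendsto_thetaHat (H : IsARNoise θ ρ s v e x) (hS : S.PosDef)
    (hc : c = θ (Fin.last q) * ρ) (hc1 : |c| < 1) (ht : ∀ i, beta θ ρ i = t i + c * t i.rev)
    (i : Fin (q + 1)) : Tendsto (fun n => thetaHat S x n i - t i) atTop (𝓝 0) := by
  have hx := H.autoregression.causal
  set r : ℕ → Fin (q + 1) → ℝ := fun n i =>
    cesaro n (predictionError t x) (shift (i + 1) x) - S.mulVec t i / (n + 1) with hr
  have hr0 : ∀ i, Tendsto (fun n => r n i) atTop (𝓝 0) := by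
    intro i
    have h1 := H.tendsto_cesaro_predictionError_shift hc hc1 ht (j := i + 1) (by omega) (by omega)
    have h2 : Tendsto (fun n : ℕ => S.mulVec t i / ((n : ℝ) + 1)) atTop (𝓝 0) := by
      simpa using (tendsto_add_atTop_iff_nat 1).2
        (tendsto_const_div_atTop_nhds_zero_nat (S.mulVec t i))
    simpa using h1.sub h2
  have hs : 0 < s / 32 := by linarith [H.pos]
  have hR : Tendsto (fun n => (∑ i, r n i ^ 2) / (s / 32) ^ 2) atTop (𝓝 0) := by
    simpa using (tendsto_finsetSum Finset.univ fun i _ => (hr0 i).pow 2).div_const _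
  have hsq : Tendsto (fun n => (thetaHat S x n i - t i) ^ 2) atTop (𝓝 0) := by
    refine squeeze_zero' (.of_forall fun n => sq_nonneg _) ?_ hR
    filter_upwards [H.eventually_le_norm_sq (q + 2), eventually_ge_atTop 1] with n h1 h2
    -- The lower bound starts at lag `0` and the regressors at lag `1`, hence the padding by `0`.
    have h3 := h1 (Fin.cons 0 (thetaHat S x n - t))
    have h4 := norm_sq_thetaHat_sub_le hx hS h2 t
    simp only [Fin.sum_univ_succ (n := q + 1), Fin.cons_zero, Fin.cons_succ, zero_smul, zero_add,
      Fin.val_succ, Pi.sub_apply, ne_eq, OfNat.ofNat_ne_zero, not_false_eq_true, zero_pow] at h3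
    set d := thetaHat S x n - t with hd
    -- Young's inequality, weighted so that half of the coercive term absorbs the part in `d`.
    have h5 : ∑ i, d i * r n i ≤
        s / 32 / 2 * ∑ i, d i ^ 2 + (∑ i, r n i ^ 2) / (2 * (s / 32)) := by
      rw [Finset.mul_sum, Finset.sum_div, ← Finset.sum_add_distrib]
      refine Finset.sum_le_sum fun i _ => ?_
      have := sq_nonneg (s / 32 * d i - r n i)
      rw [← sub_nonneg]
      have hs0 : s ≠ 0 := H.pos.ne'
      have h6 : s / 32 / 2 * d i ^ 2 + r n i ^ 2 / (2 * (s / 32)) - d i * r n i =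
          (s / 32 * d i - r n i) ^ 2 / (2 * (s / 32)) := by
        field_simp
        ring
      rw [h6]
      positivity
    have h6 : s / 32 * ∑ i, d i ^ 2 ≤ ∑ i, d i * r n i := h3.trans h4
    have h7 : d i ^ 2 ≤ ∑ i, d i ^ 2 :=
      Finset.single_le_sum (f := fun i => d i ^ 2) (fun i _ => sq_nonneg _) (Finset.mem_univ i)
    refine h7.trans ?_
    rw [le_div_iff₀ (by positivity)]
    have h8 : s / 32 / 2 * ∑ i, d i ^ 2 ≤ (∑ i, r n i ^ 2) / (2 * (s / 32)) := by linarith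
    rw [le_div_iff₀ (by positivity)] at h8
    linarith
  refine (tendsto_zero_iff_abs_tendsto_zero _).2 ?_
  simpa [Real.sqrt_sq_eq_abs, Function.comp_def] using hsq.sqrt

lemma tendsto_norm_window_predictionError_sub (H : IsARNoise θ ρ s v e x) (hS : S.PosDef)
    (hc : c = θ (Fin.last q) * ρ) (hc1 : |c| < 1) (ht : ∀ i, beta θ ρ i = t i + c * t i.rev) :
    Tendsto (fun n => ‖window n (predictionError (thetaHat S x n) x - predictionError t x)‖)
      atTop (𝓝 0) := by
  obtain ⟨W, hW⟩ := H.exists_norm_window_le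
  have h1 : Tendsto (fun n => (∑ i, |t i - thetaHat S x n i|) * W) atTop (𝓝 0) := by
    have := (tendsto_finsetSum Finset.univ
      fun i _ => (H.tendsto_thetaHat hS hc hc1 ht i).abs).mul_const W
    simpa [abs_sub_comm] using this
  refine squeeze_zero (fun n => norm_nonneg _) (fun n => ?_) h1
  rw [predictionError_sub]
  exact norm_window_sum_le n _
    fun i => (norm_window_shift_le H.autoregression.causal _ n).trans (hW n)

/-- Deterministic form of the convergence of the Durbin–Watson statistic. -/
lemma tendsto_durbinWatson (H : IsARNoise θ ρ s v e x) (hS : S.PosDef)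
    (hc : c = θ (Fin.last q) * ρ) (hc1 : |c| < 1) (ht : ∀ i, beta θ ρ i = t i + c * t i.rev) :
    Tendsto (fun n => durbinWatson S x n) atTop (𝓝 (2 * (1 - c * t (Fin.last q)))) := by
  have hx := H.autoregression.causal
  have hcausal : ∀ u : Fin (q + 1) → ℝ, Causal (predictionError u x) := fun u =>
    hx.sub (.sum_smul (a := fun i : Fin (q + 1) => shift (i + 1) x)
      (fun i => hx.comp_shift _) _)
  obtain ⟨W, hW⟩ := H.exists_norm_window_le
  set f := predictionError t x with hf
  set g : ℕ → ℤ → ℝ := fun n => predictionError (thetaHat S x n) x with hg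
  have hgf : Tendsto (fun n => ‖window n (g n - f)‖) atTop (𝓝 0) :=
    H.tendsto_norm_window_predictionError_sub hS hc hc1 ht
  have hfW : ∀ n, ‖window n f‖ ≤ W + (∑ i, |t i|) * W := fun n => by
    rw [hf, predictionError, map_sub]
    exact (norm_sub_le _ _).trans (add_le_add (hW n)
      (norm_window_sum_le n _ fun i => (norm_window_shift_le hx _ n).trans (hW n)))
  have hshift : ∀ {a : ℤ → ℝ}, Causal a → ∀ n, ‖window n (a - shift 1 a)‖ ≤ 2 * ‖window n a‖ := by
    intro a ha n
    rw [map_sub]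
    linarith [norm_sub_le (window n a) (window n (shift 1 a)), norm_window_shift_le ha 1 n]
  have hM : Tendsto (fun n => ‖window n (g n)‖ ^ 2 - ‖window n f‖ ^ 2) atTop (𝓝 0) :=
    tendsto_norm_sq_sub_norm_sq (E := fun n => EuclideanSpace ℝ (Fin (n + 1))) hfW
      (by simpa using hgf)
  have hN : Tendsto (fun n => ‖window n (g n - shift 1 (g n))‖ ^ 2 -
      ‖window n (f - shift 1 f)‖ ^ 2) atTop (𝓝 0) := by
    refine tendsto_norm_sq_sub_norm_sq (E := fun n => EuclideanSpace ℝ (Fin (n + 1)))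
      (W := 2 * (W + (∑ i, |t i|) * W))
      (fun n => (hshift (hcausal t) n).trans (by linarith [hfW n])) ?_
    have h1 := hgf.const_mul 2
    rw [mul_zero] at h1
    refine squeeze_zero (fun n => norm_nonneg _) (fun n => ?_) h1
    have h2 : g n - shift 1 (g n) - (f - shift 1 f) = (g n - f) - shift 1 (g n - f) := by
      rw [map_sub]
      abel
    rw [← map_sub, h2]
    exact hshift ((hcausal _).sub (hcausal t)) n
  have hx0 : Tendsto (fun n : ℕ => x 0 ^ 2 / ((n : ℝ) + 1)) atTop (𝓝 0) := by
    simpa using (tendsto_add_atTop_iff_nat 1).2 (tendsto_const_div_atTop_nhds_zero_nat (x 0 ^ 2))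
  have hnum := ((hN.add (H.tendsto_norm_sq_increment hc hc1 ht)).sub hx0).sub
    (hM.const_mul (2 * (1 - c * t (Fin.last q))))
  simp only [add_zero, mul_zero, sub_zero] at hnum
  -- The leading coefficient `1` alone bounds the residual energy below, whatever `thetaHat` is.
  have hlow : ∀ᶠ n in atTop, s / 32 ≤ ‖window n (g n)‖ ^ 2 := by
    filter_upwards [H.eventually_le_norm_sq (q + 2)] with n hn
    have h1 := hn (Fin.cons 1 (-thetaHat S x n))
    rw [← predictionError_eq_sum_cons] at h1
    refine le_trans ?_ h1
    rw [Fin.sum_univ_succ, Fin.cons_zero, one_pow]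
    have h2 : 0 ≤ ∑ i : Fin (q + 1),
        (Fin.cons 1 (-thetaHat S x n) : Fin (q + 2) → ℝ) i.succ ^ 2 :=
      Finset.sum_nonneg fun i _ => sq_nonneg _
    nlinarith [H.pos]
  have hs : 0 < s / 32 := by linarith [H.pos]
  rw [← tendsto_sub_nhds_zero_iff]
  have h1 := hnum.norm.div_const (s / 32)
  rw [norm_zero, zero_div] at h1
  refine squeeze_zero_norm' ?_ h1
  filter_upwards [hlow] with n hn
  have hpos : 0 < ‖window n (g n)‖ ^ 2 := hs.trans_le hn
  have h2 : durbinWatson S x n - 2 * (1 - c * t (Fin.last q)) =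
      (‖window n (g n - shift 1 (g n))‖ ^ 2 - ‖window n (f - shift 1 f)‖ ^ 2 +
        (‖window n (f - shift 1 f)‖ ^ 2 - 2 * (1 - c * t (Fin.last q)) * ‖window n f‖ ^ 2) -
        x 0 ^ 2 / ((n : ℝ) + 1) -
        2 * (1 - c * t (Fin.last q)) * (‖window n (g n)‖ ^ 2 - ‖window n f‖ ^ 2)) /
      ‖window n (g n)‖ ^ 2 := by
    rw [durbinWatson_eq hx, eq_div_iff hpos.ne', sub_mul, div_mul_cancel₀ _ hpos.ne']
    ring
  rw [h2, norm_div, Real.norm_of_nonneg hpos.le]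
  exact div_le_div_of_nonneg_left (norm_nonneg _) hs hn

end IsARNoise

/-! ### The limiting values -/

/-- Since `J² = I`, `(I + cJ)(I - cJ) = (1 - c²) I`, and `α = 1 / (1 - c²)`. -/
lemma beta_eq_thetaStar {q : ℕ} (hp : 1 ≤ q + 1) {θ : Fin (q + 1) → ℝ} {ρ c : ℝ}
    (hc : c = lastEntry hp θ * ρ) (hc1 : |c| < 1) (i : Fin (q + 1)) :
    beta θ ρ i = thetaStar hp θ ρ i + c * thetaStar hp θ ρ i.rev := by
  have hJ : ∀ (u : Fin (q + 1) → ℝ) (i : Fin (q + 1)), (exchange (q + 1)).mulVec u i = u i.rev := by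
    intro u i
    have h1 : ∀ j : Fin (q + 1), ((i : ℕ) + (j : ℕ) + 1 = q + 1) ↔ j = i.rev := fun j => by
      rw [Fin.ext_iff, Fin.val_rev]
      omega
    simp only [Matrix.mulVec, dotProduct, exchange, Matrix.of_apply, h1]
    simp
  have h2 : ∀ i, thetaStar hp θ ρ i =
      1 / ((1 - c) * (1 + c)) * (beta θ ρ i - c * beta θ ρ i.rev) := by
    intro i
    rw [thetaStar, alpha, ← hc, Pi.smul_apply, Matrix.sub_mulVec, Matrix.one_mulVec,
      Matrix.smul_mulVec, Pi.sub_apply, Pi.smul_apply, hJ, smul_eq_mul, smul_eq_mul]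
  have h3 : 1 - c ≠ 0 := by linarith [(abs_lt.1 hc1).2]
  have h4 : 1 + c ≠ 0 := by linarith [(abs_lt.1 hc1).1]
  rw [h2, h2, Fin.rev_rev]
  field_simp
  ring

/-- The trajectories of the model, extended by zero to the negative times. -/
lemma IsModel.isARNoise {Ω : Type*} {p : ℕ} {θ : Fin p → ℝ} {ρ s : ℝ} {V ε : ℕ → Ω → ℝ}
    {X : ℤ → Ω → ℝ} (H : IsModel θ ρ V ε X) (hθ : ∑ i, |θ i| < 1) (hρ : |ρ| < 1) (hs : 0 < s)
    {ω : Ω} (hω : IsWhite s (innovation (X 0 ω) fun n => V n ω)) :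
    IsARNoise θ ρ s (innovation (X 0 ω) fun n => V n ω)
      (fun k => if k < 0 then 0 else ε k.toNat ω) (fun k => if k < 0 then 0 else X k ω) where
  white := hω
  pos := hs
  noise :=
    { stable := by simpa using hρ
      causal_input := causal_innovation _ _
      causal := fun k hk => if_pos hk
      eq := by
        ext k
        simp only [Fin.sum_univ_one, Pi.add_apply, Pi.smul_apply, smul_eq_mul, shift_apply,
          Fin.val_zero]
        rcases lt_trichotomy k 0 with hk | rfl | hk
        · rw [if_pos hk, if_pos (by omega), causal_innovation _ _ _ hk]
          ring
        -- At time `0` all lags vanish, which is why the innovation there has to be `X 0`.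
        · simpa [innovation] using (H.initial ω).symm
        · lift k to ℕ using hk.le
          have hk' : 1 ≤ k := by omega
          rw [if_neg (by omega), if_neg (by omega), innovation_natCast hk', Int.toNat_natCast,
            show ((k : ℤ) - ((0 + 1 : ℕ) : ℤ)).toNat = k - 1 by omega]
          exact H.noise k hk' ω }
  autoregression :=
    { stable := hθ
      causal_input := fun k hk => if_pos hk
      causal := fun k hk => if_pos hk
      eq := by
        ext k
        simp only [Finset.sum_apply, Pi.add_apply, Pi.smul_apply, smul_eq_mul, shift_apply]
        rcases lt_trichotomy k 0 with hk | rfl | hk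
        · rw [if_pos hk, if_pos hk, Finset.sum_eq_zero, add_zero]
          intro i _
          rw [if_pos (by omega), mul_zero]
        · rw [Finset.sum_eq_zero]
          · simpa using H.initial ω
          · intro i _
            rw [if_pos (by omega), mul_zero]
        · lift k to ℕ using hk.le
          rw [if_neg (by omega), if_neg (by omega), Int.toNat_natCast,
            H.autoregression k (by omega) ω]
          congr 1
          refine Finset.sum_congr rfl fun i _ => ?_
          rw [show (k : ℤ) - (((i : ℕ) + 1 : ℕ) : ℤ) = (k : ℤ) - ((i : ℕ) : ℤ) - 1 by
            push_cast; ring]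
          split_ifs with h
          · obtain ⟨m, hm⟩ := Int.eq_ofNat_of_zero_le
              (show 0 ≤ -((k : ℤ) - ((i : ℕ) : ℤ) - 1) by omega)
            rw [show (k : ℤ) - ((i : ℕ) : ℤ) - 1 = -(m : ℤ) by omega,
              H.initial_neg m (by omega) (by omega)]
          · rfl }

end DurbinWatson

theorem mainTheorem7 {Ω : Type*} [MeasurableSpace Ω] (μ : Measure Ω) [IsProbabilityMeasure μ]
    {p : ℕ} (hp : 1 ≤ p)
    (θ : Fin p → ℝ) (hθ_ne : θ ≠ 0) (hθ : ∑ i, |θ i| < 1)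
    (ρ : ℝ) (hρ : |ρ| < 1)
    (V : ℕ → Ω → ℝ) (ε : ℕ → Ω → ℝ) (X : ℤ → Ω → ℝ)
    (hmodel : DurbinWatson.IsModel θ ρ V ε X)
    (hX0 : MemLp (X 0) 2 μ)
    (hV_meas : ∀ n : ℕ, 1 ≤ n → Measurable (V n))
    (hV_indep : iIndepFun (fun n : ℕ => V (n + 1)) μ)
    (hV_ident : ∀ n : ℕ, 1 ≤ n → IdentDistrib (V n) (V 1) μ μ)
    (hV_L2 : MemLp (V 1) 2 μ)
    (hV_mean : ∫ ω, V 1 ω ∂μ = 0)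
    (σ : ℝ) (hσ : 0 < σ) (hV_var : variance (V 1) μ = σ ^ 2)
    (S : Matrix (Fin p) (Fin p) ℝ) (hS : S.PosDef) :
    ∀ᵐ ω ∂μ,
      Tendsto (fun n : ℕ => DurbinWatson.durbinWatson S (fun k : ℤ => X k ω) n) atTop
        (𝓝 (DurbinWatson.dStar hp θ ρ)) := by
  obtain ⟨q, rfl⟩ := Nat.exists_eq_add_of_le' hp
  filter_upwards [DurbinWatson.ae_isWhite_innovation hV_meas hV_indep hV_ident hV_L2 hV_mean (X 0)]
    with ω hω
  have H := hmodel.isARNoise hθ hρ (hV_var ▸ pow_pos hσ 2) hω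
  have hlast : ∀ u : Fin (q + 1) → ℝ, DurbinWatson.lastEntry hp u = u (Fin.last q) := fun _ => rfl
  have hθq : |θ (Fin.last q)| < 1 := (Finset.single_le_sum (f := fun i => |θ i|)
    (fun i _ => abs_nonneg _) (Finset.mem_univ _)).trans_lt hθ
  have hc1 : |θ (Fin.last q) * ρ| < 1 := by
    rw [abs_mul]
    exact mul_lt_one_of_nonneg_of_lt_one_left (abs_nonneg _) hθq hρ.le
  have hlim := H.tendsto_durbinWatson hS rfl hc1
    (DurbinWatson.beta_eq_thetaStar hp (by rw [hlast]) hc1)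
  rw [DurbinWatson.dStar, DurbinWatson.rhoStar, hlast, hlast]
  -- The statistic only reads times from `-p` on, where the trajectory and its extension by zero
  -- agree.
  refine hlim.congr fun n => DurbinWatson.durbinWatson_congr (fun k hk => ?_) n
  split_ifs with h
  · obtain ⟨m, hm⟩ := Int.eq_ofNat_of_zero_le (show 0 ≤ -k by omega)
    rw [show k = -(m : ℤ) by omega, hmodel.initial_neg m (by omega) (by omega)]
  · rfl
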